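/- Let $d\ge 3$ and let $\theta\in\mathbb{Z}^d$ with $\theta_i\ge 1$ for all $i$. For $x,y\in\mathbb{Z}^d$ write $x\le_{\mathrm{lex}}y$ if $x=y$ or there is an $i$ with $x_i<y_i$ and $x_k=y_k$ for all $k>i$, and write $x\preceq y$ (the grevlex order) if $\sum_i x_i<\sum_i y_i$, or $\sum_i x_i=\sum_i y_i$ and $y\le_{\mathrm{lex}}x$. Let $$\mathcal{Q}=\operatorname{conv}\{x\in\mathbb{Z}^d : x\ge 0,\ x\preceq\theta\}\subset\mathbb{R}^d .$$ Call two distinct vertices of a polytope an antipodal pair if no facet contains both of them (pairs are unordered). A polytope $X\subset\mathbb{R}^d$ of dimension $d$ with exactly $2d$ facets is a Dantzig figure generated by $u$ and $v$ if $(u,v)$ is an antipodal pair of $X$. Then: 1. $\mathcal{Q}$ is a Dantzig figure generated by $0$ and $\theta$. In particular, $\mathcal{Q}$ is a $d$-dimensional polytope with exactly $2d$ facets, and every facet of $\mathcal{Q}$ contains exactly one of $0$ and $\theta$. 2. If $d\ge 4$, then $(0,\theta)$ is the only antipodal pair of $\mathcal{Q}$. 3. If $d=3$, then $\mathcal{Q}$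 has exactly two antipodal pairs, namely $(0,\theta)$ and $(v^{1,3},v^{2,4})$, where $$v^{1,3}=(\theta_1+\theta_2-1,\ 0,\ \theta_3+1),\qquad v^{2,4}=(0,\ \theta_1+\theta_2+\theta_3-1,\ 0);$$ in particular $\mathcal{Q}$ is also a Dantzig figure generated by $v^{1,3}$ and $v^{2,4}$. -/

import Mathlib

/-- The lexicographic order on `ℤ^d`, comparing coordinates from right to left. -/
def LexLe {d : ℕ} (x y : Fin d → ℤ) : Prop :=
  x = y ∨ ∃ i, x i < y i ∧ ∀ k, i < k → x k = y k

/-- The graded reverse lexicographic order on `ℤ^d`. -/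
def GrevlexLe {d : ℕ} (x y : Fin d → ℤ) : Prop :=
  ∑ i, x i < ∑ i, y i ∨ (∑ i, x i = ∑ i, y i ∧ LexLe y x)

/-- An integer vector, seen as a point of `ℝ^d`. -/
def realPoint {d : ℕ} (x : Fin d → ℤ) : Fin d → ℝ := fun i => (x i : ℝ)

/-- The grevlex polytope: the convex hull of the nonnegative integer points that are at most `θ`
in the grevlex order. -/
def grevlexPolytope {d : ℕ} (θ : Fin d → ℤ) : Set (Fin d → ℝ) :=
  convexHull ℝ (realPoint '' {x : Fin d → ℤ | 0 ≤ x ∧ GrevlexLe x θ})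

/-- The affine dimension of a nonempty set `X ⊆ ℝ^d`. -/
noncomputable def affDim {d : ℕ} (X : Set (Fin d → ℝ)) : ℕ :=
  Module.finrank ℝ (vectorSpan ℝ X)

/-- A full-dimensional polytope in `ℝ^d`: the convex hull of finitely many points, of affine
dimension `d`. -/
def IsFullPolytope {d : ℕ} (X : Set (Fin d → ℝ)) : Prop :=
  (∃ S : Set (Fin d → ℝ), S.Finite ∧ S.Nonempty ∧ X = convexHull ℝ S) ∧ affDim X = d

/-- `F` is a facet of `X`: a nonempty set cut out of `X` by equality in an inequality
`c x ≤ c₀` valid on `X`, whose dimension is one less than that of `X`. -/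
def IsFacet {d : ℕ} (X F : Set (Fin d → ℝ)) : Prop :=
  F.Nonempty ∧
  (∃ (c : Fin d → ℝ) (c₀ : ℝ), (∀ x ∈ X, ∑ i, c i * x i ≤ c₀) ∧
    F = {x | x ∈ X ∧ ∑ i, c i * x i = c₀}) ∧
  affDim F + 1 = affDim X

/-- Two distinct vertices of `X` that do not share a common facet. -/
def IsAntipodalPair {d : ℕ} (X : Set (Fin d → ℝ)) (u v : Fin d → ℝ) : Prop :=
  u ∈ X.extremePoints ℝ ∧ v ∈ X.extremePoints ℝ ∧ u ≠ v ∧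
  ∀ F, IsFacet X F → ¬ (u ∈ F ∧ v ∈ F)

/-- `X` is a Dantzig figure generated by `u` and `v`: a `d`-polytope in `ℝ^d` with exactly `2d`
facets, of which `u` and `v` are distinct vertices not sharing a common facet. -/
def IsDantzigFigure {d : ℕ} (X : Set (Fin d → ℝ)) (u v : Fin d → ℝ) : Prop :=
  IsFullPolytope X ∧ {F | IsFacet X F}.encard = ((2 * d : ℕ) : ℕ∞) ∧ IsAntipodalPair X u v

/-- The point `v^{j,k} = ((θ_1 + ⋯ + θ_{k-1} - 1) e_j, 0, …, 0, θ_k + 1, θ_{k+1}, …, θ_d)`, for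
`1 ≤ j < k - 1 ≤ d`. Indices `j`, `k` are counted from 1, so that `i : Fin d` is the coordinate
number `i + 1`. -/
def vPoint {d : ℕ} (θ : Fin d → ℤ) (j k : ℕ) : Fin d → ℤ := fun i =>
  if (i : ℕ) + 1 = j then (∑ l : Fin d, if (l : ℕ) + 1 < k then θ l else 0) - 1
  else if (i : ℕ) + 1 < k then 0
  else if (i : ℕ) + 1 = k then θ i + 1
  else θ i

/-! Read the coordinates of `x` backwards and put the slack `∑ θ - ∑ x` in front. This gives a
sequence `ξ_0, …, ξ_d` of fixed sum; let `η` be the sequence of `θ`, so `η_0 = 0`. Then `x ⪯ θ`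
means that `ξ = η` or `ξ_r > η_r` at the first place where they differ.

Put `b_0 = -1` and `b_{r+1} = (1 + η_r) b_r + ξ_r` (`excess`). While `ξ` agrees with `η`, `b` stays
at `-1`; a first difference with `ξ_r ≥ η_r + 1` lifts it to a nonnegative value, and it never
decreases later. Hence the `d` inequalities `b_{r+1} - b_r ≥ 0` for `r < d` (`upperForm`) and the
`d` inequalities `ξ_r ≥ 0` for `1 ≤ r ≤ d` hold on the polytope (`realPoint_mem_hPolytope`).

They suffice: the increments of `b` are the weights of an explicit convex combination of the points
`(i, k)`, which follow `η` before `k`, take `η_k + 1` at `k`, and put the remaining mass at `i ≥ k`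
(`exists_weights`). Points with `i = k + 1` are redundant. So the polytope is at once `hPolytope
(facetForm θ)` and the hull of `vertexSet θ`.

Exhibiting, for any two of the `2d` inequalities, a point tight for the first only
(`separated_facetForm`) makes them exactly the facets. The first `d` are tight at `0` and not at
`θ`, the others at `θ` and not at `0`. Antipodal pairs then reduce to a finite incidence question on
the indices `(i, k)`, settled in `index_of_no_common_facet`. -/

open Filter Topology

/-! ### Facets of an irredundant system of affine inequalities -/

section HPolytope

variable {d : ℕ} {ι : Type*}

/-- The solution set of a system of affine inequalities `0 ≤ f i`. -/
def hPolytope (f : ι → (Fin d → ℝ) →ᵃ[ℝ] ℝ) : Set (Fin d → ℝ) := {x | ∀ i, 0 ≤ f i x}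

/-- The face of a system of affine inequalities on which the inequality `i` is tight. -/
def hFace (f : ι → (Fin d → ℝ) →ᵃ[ℝ] ℝ) (i : ι) : Set (Fin d → ℝ) :=
  {x | x ∈ hPolytope f ∧ f i x = 0}

/-- Any two different inequalities are separated by a point that is tight for the first only. -/
def Separated (f : ι → (Fin d → ℝ) →ᵃ[ℝ] ℝ) : Prop :=
  ∀ i j, i ≠ j → ∃ q ∈ hPolytope f, f i q = 0 ∧ 0 < f j q

theorem affine_combo (g : (Fin d → ℝ) →ᵃ[ℝ] ℝ) {x y : Fin d → ℝ} {a b : ℝ} (hab : a + b = 1) :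
    g (a • x + b • y) = a * g x + b * g y := by
  simpa using Convex.combo_affine_apply (f := g) (x := x) (y := y) hab

theorem affine_add_smul (g : (Fin d → ℝ) →ᵃ[ℝ] ℝ) (x v : Fin d → ℝ) (t : ℝ) :
    g (x + t • v) = g x + t * g.linear v := by
  have := g.map_vadd x (t • v)
  simp only [vadd_eq_add, map_smul, smul_eq_mul] at this
  rw [add_comm x, this, add_comm]

theorem affine_sub (g : (Fin d → ℝ) →ᵃ[ℝ] ℝ) (x y : Fin d → ℝ) :
    g.linear (x - y) = g x - g y := by
  simpa using g.linearMap_vsub x y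

theorem convex_hPolytope (f : ι → (Fin d → ℝ) →ᵃ[ℝ] ℝ) : Convex ℝ (hPolytope f) := by
  intro x hx y hy a b ha hb hab i
  rw [affine_combo _ hab]
  exact add_nonneg (mul_nonneg ha (hx i)) (mul_nonneg hb (hy i))

theorem convex_hFace (f : ι → (Fin d → ℝ) →ᵃ[ℝ] ℝ) (i : ι) : Convex ℝ (hFace f i) := by
  intro x hx y hy a b ha hb hab
  refine ⟨convex_hPolytope f hx.1 hy.1 ha hb hab, ?_⟩
  rw [affine_combo _ hab, hx.2, hy.2]; simp

/-- Midpoints do it: every form is nonnegative on `F`, so the midpoint of a point good for `s` and a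
point good for `a` is good for both. -/
theorem exists_forall_pos {κ : Type*} (f : κ → (Fin d → ℝ) →ᵃ[ℝ] ℝ) {F : Set (Fin d → ℝ)}
    (hF : Convex ℝ F) (hne : F.Nonempty) (hnn : ∀ x ∈ F, ∀ i, 0 ≤ f i x) (s : Finset κ)
    (h : ∀ i ∈ s, ∃ x ∈ F, 0 < f i x) : ∃ p ∈ F, ∀ i ∈ s, 0 < f i p := by
  classical
  induction s using Finset.induction_on with
  | empty => exact ⟨hne.some, hne.some_mem, by simp⟩
  | insert a s _ ih =>
    obtain ⟨p, hp, hps⟩ := ih fun i hi => h i (Finset.mem_insert_of_mem hi)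
    obtain ⟨q, hq, hqa⟩ := h a (Finset.mem_insert_self a s)
    have hab : (1 / 2 : ℝ) + 1 / 2 = 1 := by norm_num
    refine ⟨(1 / 2 : ℝ) • p + (1 / 2 : ℝ) • q,
      hF hp hq (by norm_num) (by norm_num) hab, fun i hi => ?_⟩
    rw [affine_combo _ hab]
    rcases Finset.mem_insert.1 hi with rfl | hi
    · linarith [hnn p hp i]
    · linarith [hnn q hq i, hps i hi]

/-- The tight inequalities do not change along `v`, and by continuity the finitely many slack ones
survive a small step. -/
theorem exists_step [Finite ι] {f : ι → (Fin d → ℝ) →ᵃ[ℝ] ℝ} {p v : Fin d → ℝ}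
    (hp : p ∈ hPolytope f)
    (hv : ∀ i, f i p = 0 → (f i).linear v = 0) :
    ∃ t : ℝ, 0 < t ∧ p + t • v ∈ hPolytope f := by
  have h : ∀ᶠ t : ℝ in 𝓝[>] 0, ∀ i, 0 ≤ f i (p + t • v) := by
    rw [eventually_all]
    intro i
    simp only [affine_add_smul]
    rcases (hp i).eq_or_lt with h0 | h0
    · simp [← h0, hv i h0.symm]
    · have hc : Tendsto (fun t : ℝ => f i p + t * (f i).linear v) (𝓝[>] 0) (𝓝 (f i p)) := by
        have : Continuous fun t : ℝ => f i p + t * (f i).linear v := by fun_prop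
        simpa using (this.tendsto 0).mono_left nhdsWithin_le_nhds
      exact (hc.eventually (lt_mem_nhds h0)).mono fun t ht => ht.le
  obtain ⟨t, ht, ht0⟩ := (h.and self_mem_nhdsWithin).exists
  exact ⟨t, ht0, ht⟩

/-- A point in the relative interior of the face `i`. -/
theorem exists_mem_hFace [Finite ι] {f : ι → (Fin d → ℝ) →ᵃ[ℝ] ℝ} (hs : Separated f)
    [Nontrivial ι] (i : ι) :
    ∃ p ∈ hFace f i, ∀ j, j ≠ i → 0 < f j p := by
  classical
  have := Fintype.ofFinite ι
  obtain ⟨j, hj⟩ := exists_ne i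
  obtain ⟨q, hq, hqi, -⟩ := hs i j hj.symm
  obtain ⟨p, hp, h⟩ := exists_forall_pos f (convex_hFace f i) ⟨q, hq, hqi⟩
    (fun x hx j => hx.1 j) (Finset.univ.erase i) (by
      intro j hj
      obtain ⟨q, hq, hqi, hqj⟩ := hs i j (Finset.ne_of_mem_erase hj).symm
      exact ⟨q, ⟨hq, hqi⟩, hqj⟩)
  exact ⟨p, hp, fun j hj => h j (Finset.mem_erase.2 ⟨hj, Finset.mem_univ j⟩)⟩

theorem exists_interior [Finite ι] {f : ι → (Fin d → ℝ) →ᵃ[ℝ] ℝ} (hs : Separated f) [Nontrivial ι] :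
    ∃ p ∈ hPolytope f, ∀ j, 0 < f j p := by
  have := Fintype.ofFinite ι
  have hex : ∀ i, ∃ x ∈ hPolytope f, 0 < f i x := by
    intro i
    obtain ⟨j, hj⟩ := exists_ne i
    obtain ⟨q, hq, -, h⟩ := hs j i hj
    exact ⟨q, hq, h⟩
  obtain ⟨i⟩ : Nonempty ι := inferInstance
  obtain ⟨q, hq, -⟩ := hex i
  obtain ⟨p, hp, h⟩ := exists_forall_pos f (convex_hPolytope f) ⟨q, hq⟩ (fun x hx j => hx j)
    Finset.univ fun i _ => hex i
  exact ⟨p, hp, fun j => h j (Finset.mem_univ j)⟩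

theorem mem_vectorSpan_of_add_smul {s : Set (Fin d → ℝ)} {p v : Fin d → ℝ} {t : ℝ} (ht : t ≠ 0)
    (hp : p ∈ s) (h : p + t • v ∈ s) : v ∈ vectorSpan ℝ s := by
  have := vsub_mem_vectorSpan ℝ h hp
  simp only [vsub_eq_sub, add_sub_cancel_left] at this
  exact (Submodule.smul_mem_iff _ ht).1 this

theorem affDim_hPolytope [Finite ι] {f : ι → (Fin d → ℝ) →ᵃ[ℝ] ℝ} (hs : Separated f)
    [Nontrivial ι] :
    affDim (hPolytope f) = d := by
  obtain ⟨p, hp, h⟩ := exists_interior hs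
  have : vectorSpan ℝ (hPolytope f) = ⊤ := by
    rw [eq_top_iff]
    intro v _
    obtain ⟨t, ht, htv⟩ := exists_step (v := v) hp fun i hi => absurd hi (h i).ne'
    exact mem_vectorSpan_of_add_smul ht.ne' hp htv
  rw [affDim, this, finrank_top, Module.finrank_fin_fun]

/-- At a relative interior point of the face only inequality `i` is tight, so a small step in any
direction of its kernel stays in the face. -/
theorem vectorSpan_hFace [Finite ι] {f : ι → (Fin d → ℝ) →ᵃ[ℝ] ℝ} (hs : Separated f)
    [Nontrivial ι] (i : ι) :
    vectorSpan ℝ (hFace f i) = LinearMap.ker (f i).linear := by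
  apply le_antisymm
  · rw [vectorSpan_def, Submodule.span_le]
    rintro _ ⟨x, hx, y, hy, rfl⟩
    simp [affine_sub, hx.2, hy.2]
  · intro v hv
    obtain ⟨p, hp, h⟩ := exists_mem_hFace hs i
    obtain ⟨t, ht, htv⟩ := exists_step (v := v) hp.1 fun j hj => by
      by_cases hji : j = i
      · subst hji; exact hv
      · exact absurd hj (h j hji).ne'
    refine mem_vectorSpan_of_add_smul ht.ne' hp ⟨htv, ?_⟩
    rw [affine_add_smul, hp.2, LinearMap.mem_ker.1 hv]; simp

theorem affDim_hFace [Finite ι] {f : ι → (Fin d → ℝ) →ᵃ[ℝ] ℝ} (hs : Separated f)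
    [Nontrivial ι] (i : ι) :
    affDim (hFace f i) + 1 = d := by
  rw [affDim, vectorSpan_hFace hs]
  have hne : (f i).linear ≠ 0 := by
    intro h0
    obtain ⟨p, hp, -⟩ := exists_mem_hFace hs i
    obtain ⟨q, -, hq⟩ := exists_interior hs
    have := affine_sub (f i) q p
    rw [h0, hp.2] at this
    simp only [LinearMap.zero_apply, sub_zero] at this
    exact (hq i).ne this
  simpa using Module.Dual.finrank_ker_add_one_of_ne_zero hne

theorem linear_eq_sum (l : (Fin d → ℝ) →ₗ[ℝ] ℝ) (x : Fin d → ℝ) :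
    l x = ∑ j, l (Pi.single j 1) * x j := by
  rw [LinearMap.pi_apply_eq_sum_univ l x]
  refine Finset.sum_congr rfl fun j _ => ?_
  rw [smul_eq_mul, mul_comm]
  congr 2
  ext k
  simp [Pi.single_apply, eq_comm]

theorem affine_eq_sum (g : (Fin d → ℝ) →ᵃ[ℝ] ℝ) (x : Fin d → ℝ) :
    g x = g 0 + ∑ j, g.linear (Pi.single j 1) * x j := by
  rw [← linear_eq_sum]
  have := affine_sub g x 0
  rw [sub_zero] at this
  rw [this]; ring

theorem isFacet_hFace [Finite ι] {f : ι → (Fin d → ℝ) →ᵃ[ℝ] ℝ} (hs : Separated f)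
    [Nontrivial ι] (i : ι) :
    IsFacet (hPolytope f) (hFace f i) := by
  refine ⟨?_, ⟨fun j => -(f i).linear (Pi.single j 1), f i 0, ?_, ?_⟩, ?_⟩
  · obtain ⟨p, hp, -⟩ := exists_mem_hFace hs i
    exact ⟨p, hp⟩
  · intro x hx
    have := hx i
    rw [affine_eq_sum] at this
    simp only [neg_mul, Finset.sum_neg_distrib]
    linarith
  · ext x
    simp only [hFace, Set.mem_ofPred_eq, neg_mul, Finset.sum_neg_distrib]
    rw [affine_eq_sum (f i) x]
    refine and_congr_right fun _ => ⟨fun h => by linarith, fun h => by linarith⟩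
  · rw [affDim_hFace hs, affDim_hPolytope hs]

/-- If each inequality were slack somewhere on `F`, then `F` would contain a point where all are
slack. A linear form maximal there is zero, so `F` would be the whole polytope, against its
dimension. Hence `F` lies in some `hFace f i`, and equality of dimensions gives equality of
direction spaces. -/
theorem eq_hFace_of_isFacet [Finite ι] {f : ι → (Fin d → ℝ) →ᵃ[ℝ] ℝ} (hs : Separated f)
    [Nontrivial ι]
    {F : Set (Fin d → ℝ)} (hF : IsFacet (hPolytope f) F) : ∃ i, F = hFace f i := by
  have := Fintype.ofFinite ι
  obtain ⟨hne, ⟨c, c₀, hle, rfl⟩, hdim⟩ := hF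
  set l : (Fin d → ℝ) →ₗ[ℝ] ℝ := Fintype.linearCombination ℝ c with hl
  have hlx : ∀ x, ∑ i, c i * x i = l x := by
    intro x
    simp [hl, Fintype.linearCombination_apply, mul_comm]
  simp only [hlx] at hle hdim hne ⊢
  set F : Set (Fin d → ℝ) := {x | x ∈ hPolytope f ∧ l x = c₀} with hFdef
  have hconv : Convex ℝ F := by
    intro x hx y hy a b ha hb hab
    refine ⟨convex_hPolytope f hx.1 hy.1 ha hb hab, ?_⟩
    rw [map_add, map_smul, map_smul, hx.2, hy.2, ← add_smul, hab, one_smul]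
  have hsub : ∃ i, ∀ x ∈ F, f i x = 0 := by
    by_contra! hcon
    obtain ⟨p, hp, hpos⟩ := exists_forall_pos f hconv hne (fun x hx => hx.1) Finset.univ
      fun i _ => by
        obtain ⟨x, hx, h0⟩ := hcon i
        exact ⟨x, hx, lt_of_le_of_ne (hx.1 i) h0.symm⟩
    have hlv : ∀ v, l v ≤ 0 := by
      intro v
      obtain ⟨t, ht, htv⟩ := exists_step (v := v) hp.1
        fun i hi => absurd hi (hpos i (Finset.mem_univ i)).ne'
      have := hle _ htv
      rw [map_add, map_smul, hp.2, smul_eq_mul] at this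
      exact nonpos_of_mul_nonpos_right (by linarith) ht
    have hl0 : ∀ v, l v = 0 := by
      intro v
      have h1 := hlv (-v)
      rw [map_neg] at h1
      exact le_antisymm (hlv v) (by linarith)
    have hFX : F = hPolytope f := by
      ext x
      refine ⟨fun hx => hx.1, fun hx => ⟨hx, ?_⟩⟩
      rw [← hp.2, hl0, hl0]
    rw [hFX] at hdim
    omega
  obtain ⟨i, hi⟩ := hsub
  have hFi : F ⊆ hFace f i := fun x hx => ⟨hx.1, hi x hx⟩
  have hspan : vectorSpan ℝ F = LinearMap.ker (f i).linear := by
    rw [← vectorSpan_hFace hs]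
    apply Submodule.eq_of_le_of_finrank_eq (vectorSpan_mono ℝ hFi)
    have h1 := affDim_hFace hs i
    rw [affDim_hPolytope hs] at hdim
    unfold affDim at h1 hdim
    omega
  -- Thus `l` is constant along the whole face `i`, not only along `F`.
  have hker : LinearMap.ker (f i).linear ≤ LinearMap.ker l := by
    rw [← hspan, vectorSpan_def, Submodule.span_le]
    rintro _ ⟨x, hx, y, hy, rfl⟩
    simp [hx.2, hy.2]
  refine ⟨i, hFi.antisymm fun x hx => ⟨hx.1, ?_⟩⟩
  obtain ⟨a, ha⟩ := hne
  have hxa : x - a ∈ LinearMap.ker (f i).linear := by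
    simp [affine_sub, hx.2, hi a ha]
  have := hker hxa
  rw [LinearMap.mem_ker, map_sub, ha.2] at this
  linarith

theorem isFacet_iff [Finite ι] {f : ι → (Fin d → ℝ) →ᵃ[ℝ] ℝ} (hs : Separated f) [Nontrivial ι]
    {F : Set (Fin d → ℝ)} : IsFacet (hPolytope f) F ↔ ∃ i, F = hFace f i :=
  ⟨eq_hFace_of_isFacet hs, by rintro ⟨i, rfl⟩; exact isFacet_hFace hs i⟩

theorem hFace_injective {f : ι → (Fin d → ℝ) →ᵃ[ℝ] ℝ} (hs : Separated f) :
    Function.Injective (hFace f) := by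
  intro i j hij
  by_contra hne
  obtain ⟨q, hq, hqi, hqj⟩ := hs i j hne
  have : q ∈ hFace f j := hij ▸ ⟨hq, hqi⟩
  exact hqj.ne' this.2

theorem encard_facets [Finite ι] {f : ι → (Fin d → ℝ) →ᵃ[ℝ] ℝ} (hs : Separated f) [Nontrivial ι] :
    {F | IsFacet (hPolytope f) F}.encard = (Nat.card ι : ℕ∞) := by
  have : {F | IsFacet (hPolytope f) F} = Set.range (hFace f) := by
    ext F
    simp [isFacet_iff hs, eq_comm]
  rw [this, ← Set.image_univ, (hFace_injective hs).encard_image, Set.encard_univ,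
    ENat.card_eq_coe_natCard]

/-- An inequality tight at `p` is tight at both ends of any open segment of the polytope through
`p`. -/
theorem mem_extremePoints_of_tight {f : ι → (Fin d → ℝ) →ᵃ[ℝ] ℝ} {p : Fin d → ℝ}
    (hp : p ∈ hPolytope f) (h : ∀ x, (∀ i, f i p = 0 → f i x = 0) → x = p) :
    p ∈ (hPolytope f).extremePoints ℝ := by
  refine ⟨hp, ?_⟩
  rintro x hx y hy ⟨a, b, ha, hb, hab, rfl⟩
  apply h
  intro i hi
  rw [affine_combo _ hab] at hi
  nlinarith [mul_nonneg ha.le (hx i), mul_nonneg hb.le (hy i), hx i, hy i]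

theorem isAntipodalPair_iff [Finite ι] {f : ι → (Fin d → ℝ) →ᵃ[ℝ] ℝ} (hs : Separated f)
    [Nontrivial ι]
    {u v : Fin d → ℝ} : IsAntipodalPair (hPolytope f) u v ↔
      u ∈ (hPolytope f).extremePoints ℝ ∧ v ∈ (hPolytope f).extremePoints ℝ ∧ u ≠ v ∧
        ∀ i, ¬ (f i u = 0 ∧ f i v = 0) := by
  unfold IsAntipodalPair
  refine and_congr_right fun hu => and_congr_right fun hv => and_congr_right fun _ => ?_
  constructor
  · intro h i hi
    exact h _ (isFacet_hFace hs i) ⟨⟨hu.1, hi.1⟩, ⟨hv.1, hi.2⟩⟩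
  · intro h F hF hm
    obtain ⟨i, rfl⟩ := eq_hFace_of_isFacet hs hF
    exact h i ⟨hm.1.2, hm.2.2⟩

end HPolytope

/-! ### Reversed homogeneous coordinates -/

section HomCoord

variable {d : ℕ} {R : Type*} [CommRing R]

/-- The coordinates of `x` in reversed order, preceded by the slack `s - ∑ i, x i`. -/
def homCoord (s : R) (x : Fin d → R) (r : ℕ) : R :=
  if h : d - r < d then x ⟨d - r, h⟩ else s - ∑ i, x i

/-- The point whose coordinates, in reversed order, are `ζ 1, …, ζ d`. -/
def ptOf (d : ℕ) (ζ : ℕ → R) : Fin d → R := fun i => ζ (d - i)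

theorem homCoord_zero (s : R) (x : Fin d → R) : homCoord s x 0 = s - ∑ i, x i := by
  simp [homCoord]

theorem homCoord_sub (s : R) (x : Fin d → R) (i : Fin d) : homCoord s x (d - i) = x i := by
  have h : d - (d - (i : ℕ)) = i := by omega
  simp [homCoord, h]

theorem homCoord_of_pos (s : R) (x : Fin d → R) {r : ℕ} (h1 : 1 ≤ r) (hd : r ≤ d) :
    homCoord s x r = x ⟨d - r, by omega⟩ := by
  have : d - r < d := by omega
  simp [homCoord, this]

theorem sum_homCoord (s : R) (x : Fin d → R) :
    ∑ r ∈ Finset.range (d + 1), homCoord s x r = s := by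
  rw [Finset.sum_range_succ', homCoord_zero,
    ← Fin.sum_univ_eq_sum_range (fun r => homCoord s x (r + 1)) d]
  have : ∑ i : Fin d, homCoord s x ((i : ℕ) + 1) = ∑ i, x i := by
    rw [← Equiv.sum_comp Fin.revPerm]
    refine Finset.sum_congr rfl fun i _ => ?_
    rw [← homCoord_sub s x i]
    congr 1
    simp [Fin.val_rev]
    omega
  rw [this]; ring

theorem sum_ptOf (ζ : ℕ → R) :
    ∑ i, ptOf d ζ i = ∑ r ∈ Finset.range (d + 1), ζ r - ζ 0 := by
  rw [Finset.sum_range_succ', ← Fin.sum_univ_eq_sum_range (fun r => ζ (r + 1)) d,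
    ← Equiv.sum_comp Fin.revPerm, add_sub_cancel_right]
  refine Finset.sum_congr rfl fun i _ => ?_
  unfold ptOf
  congr 1
  simp [Fin.val_rev]
  omega

theorem homCoord_ptOf {s : R} {ζ : ℕ → R} (hs : ∑ r ∈ Finset.range (d + 1), ζ r = s) {r : ℕ}
    (hr : r ≤ d) : homCoord s (ptOf d ζ) r = ζ r := by
  rcases Nat.eq_zero_or_pos r with rfl | h
  · rw [homCoord_zero, sum_ptOf, hs]; ring
  · rw [homCoord_of_pos s _ h hr]
    simp only [ptOf]
    congr 1
    omega

theorem ext_homCoord {s : R} {x y : Fin d → R}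
    (h : ∀ r, 1 ≤ r → r ≤ d → homCoord s x r = homCoord s y r) : x = y := by
  ext i
  rw [← homCoord_sub s x i, ← homCoord_sub s y i]
  exact h _ (by omega) (by omega)

theorem homCoord_realPoint (s : ℤ) (x : Fin d → ℤ) (r : ℕ) :
    homCoord (s : ℝ) (realPoint x) r = (homCoord s x r : ℤ) := by
  unfold homCoord realPoint
  split <;> simp

/-- In reversed homogeneous coordinates, the grevlex order is a lexicographic order. -/
theorem grevlexLe_iff {x θ : Fin d → ℤ} : GrevlexLe x θ ↔ x = θ ∨ ∃ r ≤ d,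
    homCoord (∑ i, θ i) θ r < homCoord (∑ i, θ i) x r ∧
      ∀ s < r, homCoord (∑ i, θ i) x s = homCoord (∑ i, θ i) θ s := by
  constructor
  · rintro (h | ⟨h, rfl | ⟨i, hi, hik⟩⟩)
    · refine Or.inr ⟨0, by omega, ?_, by simp⟩
      simpa [homCoord_zero] using h
    · exact Or.inl rfl
    · refine Or.inr ⟨d - i, by omega, by simpa [homCoord_sub] using hi, fun s hs => ?_⟩
      rcases Nat.eq_zero_or_pos s with rfl | h0
      · simp [homCoord_zero, h]
      · rw [homCoord_of_pos _ _ h0 (by omega), homCoord_of_pos _ _ h0 (by omega)]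
        refine (hik _ ?_).symm
        rw [Fin.lt_def]
        simp only
        omega
  · rintro (rfl | ⟨r, hr, h, hs⟩)
    · exact Or.inr ⟨rfl, Or.inl rfl⟩
    · rcases Nat.eq_zero_or_pos r with rfl | h0
      · left
        simpa [homCoord_zero] using h
      · right
        have h00 := hs 0 h0
        simp only [homCoord_zero] at h00
        refine ⟨by linarith, Or.inr ⟨⟨d - r, by omega⟩, ?_, fun k hk => ?_⟩⟩
        · rwa [homCoord_of_pos _ _ h0 hr, homCoord_of_pos _ _ h0 hr] at h
        · rw [← homCoord_sub (∑ i, θ i) x k, ← homCoord_sub (∑ i, θ i) θ k]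
          rw [Fin.lt_def] at hk
          simp only at hk
          exact (hs _ (by omega)).symm

end HomCoord

/-! ### Excess sequence, facet forms and vertex sequences -/

section Sequences

/-- The accumulated excess of `ξ` over `η`. -/
def excess (η : ℕ → ℤ) (ξ : ℕ → ℝ) : ℕ → ℝ
  | 0 => -1
  | r + 1 => (1 + η r) * excess η ξ r + ξ r

/-- The left-hand side of the `r`-th facet inequality that is tight at `η`. -/
def upperForm (η : ℕ → ℤ) (ξ : ℕ → ℝ) (r : ℕ) : ℝ := ξ r + η r * excess η ξ r

theorem excess_succ_eq_add (η : ℕ → ℤ) (ξ : ℕ → ℝ) (r : ℕ) :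
    excess η ξ (r + 1) = excess η ξ r + upperForm η ξ r := by
  simp only [excess, upperForm]; ring

theorem excess_eq_neg_one {η : ℕ → ℤ} {ξ : ℕ → ℝ} {r : ℕ} (h : ∀ s < r, ξ s = η s) :
    ∀ s ≤ r, excess η ξ s = -1 := by
  intro s
  induction s with
  | zero => intro _; rfl
  | succ s ih =>
    intro hs
    rw [excess, ih (by omega), h s (by omega)]; ring

/-- The sum of the entries of `η` after position `k`. -/
def tailSum (d : ℕ) (η : ℕ → ℤ) (k : ℕ) : ℤ := ∑ r ∈ Finset.Ioc k d, η r

theorem tailSum_eq_add {d k : ℕ} (η : ℕ → ℤ) (hk : k < d) :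
    tailSum d η k = η (k + 1) + tailSum d η (k + 1) := by
  unfold tailSum
  rw [← Finset.sum_Ioc_consecutive η (Nat.le_succ k) hk]
  simp

theorem tailSum_self (d : ℕ) (η : ℕ → ℤ) : tailSum d η d = 0 := by simp [tailSum]

theorem le_tailSum {d : ℕ} {η : ℕ → ℤ} (hη : ∀ r, 1 ≤ r → r ≤ d → 1 ≤ η r) {k : ℕ} (hk : k ≤ d) :
    (d : ℤ) - k ≤ tailSum d η k := by
  have : ∑ r ∈ Finset.Ioc k d, (1 : ℤ) ≤ tailSum d η k := by
    apply Finset.sum_le_sum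
    intro r hr
    rw [Finset.mem_Ioc] at hr
    exact hη r (by omega) hr.2
  simp only [Finset.sum_const, Nat.card_Ioc, nsmul_eq_mul, mul_one] at this
  omega

/-- The homogeneous coordinates of the vertices. -/
def vertexSeq (d : ℕ) (η : ℕ → ℤ) (i k r : ℕ) : ℤ :=
  (if r = i then tailSum d η k - 1 else 0) + (if r = k then η k + 1 else 0) +
    if r < k then η r else 0

theorem sum_vertexSeq {d : ℕ} (η : ℕ → ℤ) (h0 : η 0 = 0) {i k : ℕ} (hi : i ≤ d) (hk : k ≤ d) :
    ∑ r ∈ Finset.range (d + 1), vertexSeq d η i k r = tailSum d η 0 := by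
  have h1 : ∑ r ∈ Finset.range (d + 1), (if r < k then η r else 0) = ∑ r ∈ Finset.range k, η r := by
    rw [← Finset.sum_filter]
    congr 1
    ext r
    simp only [Finset.mem_filter, Finset.mem_range]
    omega
  have h2 : tailSum d η 0 = ∑ r ∈ Finset.range k, η r + η k + tailSum d η k := by
    rw [← Finset.sum_range_succ]
    induction k with
    | zero => simp [h0]
    | succ k ih =>
      rw [ih (by omega), tailSum_eq_add η (by omega : k < d), Finset.sum_range_succ _ (k + 1)]
      · ring
      · rw [← Finset.sum_filter]
        congr 1
        ext r
        simp only [Finset.mem_filter, Finset.mem_range]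
        omega
  unfold vertexSeq
  rw [Finset.sum_add_distrib, Finset.sum_add_distrib, h1, Finset.sum_ite_eq', Finset.sum_ite_eq',
    if_pos (by simp; omega), if_pos (by simp; omega), h2]
  ring

/-- With the weights of `exists_weights`, the left side is the average of the mass `tailSum d η k -
1` placed at position `i`. The right side says how this mass is shared among the positions from `m`
to `d`. -/
theorem sum_excess_mul_tailSum {d : ℕ} {η : ℕ → ℤ} {ξ : ℕ → ℝ} (h0 : η 0 = 0)
    (hsum : ∑ r ∈ Finset.range (d + 1), ξ r = tailSum d η 0) {m : ℕ} (hm : m ≤ d) :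
    ∑ k ∈ Finset.range m, (excess η ξ (k + 1) - excess η ξ k) * (tailSum d η k - 1) -
      excess η ξ m * (tailSum d η m - 1) = excess η ξ (m + 1) + ∑ r ∈ Finset.Ioc m d, ξ r := by
  induction m with
  | zero =>
    have : ∑ r ∈ Finset.range (d + 1), ξ r = ∑ r ∈ Finset.Ioc 0 d, ξ r + ξ 0 := by
      rw [Finset.sum_range_succ', Finset.range_eq_Ico, Finset.sum_Ico_add' ξ 0 d 1]
      congr 1
    simp only [Finset.range_zero, Finset.sum_empty, excess, h0, ← hsum, this]
    push_cast
    ring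
  | succ m ih =>
    have ih := ih (by omega)
    have hT := tailSum_eq_add η (by omega : m < d)
    have hS : ∑ r ∈ Finset.Ioc m d, ξ r = ξ (m + 1) + ∑ r ∈ Finset.Ioc (m + 1) d, ξ r := by
      rw [← Finset.sum_Ioc_consecutive ξ (Nat.le_succ m) hm]
      simp
    rw [Finset.sum_range_succ]
    rw [hS] at ih
    have hTr : (tailSum d η m : ℝ) = η (m + 1) + tailSum d η (m + 1) := by exact_mod_cast hT
    have hb : excess η ξ (m + 1 + 1) = (1 + η (m + 1)) * excess η ξ (m + 1) + ξ (m + 1) := rfl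
    rw [hb]
    rw [hTr] at ih ⊢
    linear_combination ih

end Sequences

/-! ### Writing a feasible sequence as a mixture of vertex sequences -/

section Decomposition

/-- The accumulated excess, cut off after position `m`. -/
def truncExcess (η : ℕ → ℤ) (ξ : ℕ → ℝ) (m k : ℕ) : ℝ := if k ≤ m then excess η ξ k else 0

theorem exists_row_weights {d m : ℕ} (hm : m ≤ d) (ξ : ℕ → ℝ) (c e : ℝ)
    (hξ : ∀ r, 1 ≤ r → r ≤ d → 0 ≤ ξ r) (hC : c = e + ∑ r ∈ Finset.Ioc m d, ξ r)
    (he : m < d → 0 < e) :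
    ∃ ρ : ℕ → ℝ, (∀ i ∈ Finset.Icc m d, 0 ≤ ρ i) ∧ ∑ i ∈ Finset.Icc m d, ρ i = 1 ∧
      ρ m * c = e ∧ ∀ i, m < i → i ≤ d → ρ i * c = ξ i := by
  rcases hm.eq_or_lt with rfl | hlt
  -- Only one index is left, so no division is needed and `c` may vanish.
  · refine ⟨fun _ => 1, by simp, by simp, by simp [hC], fun i h1 h2 => by omega⟩
  · have he := he hlt
    have hS : 0 ≤ ∑ r ∈ Finset.Ioc m d, ξ r := Finset.sum_nonneg fun r hr => by
      rw [Finset.mem_Ioc] at hr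
      exact hξ r (by omega) hr.2
    have hc : 0 < c := by linarith
    refine ⟨fun i => if i = m then e / c else ξ i / c, fun i hi => ?_, ?_, ?_, fun i h1 h2 => ?_⟩
    · rw [Finset.mem_Icc] at hi
      dsimp only
      split
      · positivity
      · exact div_nonneg (hξ i (by omega) hi.2) hc.le
    · rw [← Finset.add_sum_Ioc_eq_sum_Icc hm, if_pos rfl,
        Finset.sum_congr rfl (g := fun i => ξ i / c), ← Finset.sum_div, ← add_div, ← hC,
        div_self hc.ne']
      intro i hi
      rw [Finset.mem_Ioc] at hi
      rw [if_neg (by omega)]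
    · simp [hc.ne']
    · dsimp only
      rw [if_neg (by omega), div_mul_cancel₀ _ hc.ne']

/-- A nonnegative sequence satisfying the upper inequalities is a mixture of vertex sequences. -/
theorem exists_weights {d : ℕ} {η : ℕ → ℤ} {ξ : ℕ → ℝ} (h0 : η 0 = 0)
    (hsum : ∑ r ∈ Finset.range (d + 1), ξ r = tailSum d η 0)
    (hξ : ∀ r, 1 ≤ r → r ≤ d → 0 ≤ ξ r) (hu : ∀ r < d, 0 ≤ upperForm η ξ r) :
    ∃ m ≤ d, ∃ lam ρ : ℕ → ℝ, (∀ k ∈ Finset.range (m + 1), 0 ≤ lam k) ∧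
      ∑ k ∈ Finset.range (m + 1), lam k = 1 ∧ (∀ i ∈ Finset.Icc m d, 0 ≤ ρ i) ∧
      ∑ i ∈ Finset.Icc m d, ρ i = 1 ∧ ∀ r ≤ d,
        ∑ k ∈ Finset.range (m + 1), lam k *
          ∑ i ∈ Finset.Icc m d, ρ i * (vertexSeq d η i k r : ℝ) = ξ r := by
  classical
  set b := excess η ξ with hb
  -- By `hu`, `b` is nondecreasing up to `d` and starts at `-1`; `m` is the last index up to `d`
  -- where it is nonpositive.
  set m := Nat.findGreatest (fun m => b m ≤ 0) d with hmdef
  have hmd : m ≤ d := Nat.findGreatest_le d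
  have hbm : b m ≤ 0 :=
    Nat.findGreatest_spec (P := fun m => b m ≤ 0) (Nat.zero_le d) (by simp [hb, excess])
  have hbm1 : m < d → 0 < b (m + 1) := fun h =>
    not_le.1 (Nat.findGreatest_is_greatest (P := fun m => b m ≤ 0) (Nat.lt_succ_self m) h)
  set c := truncExcess η ξ m with hc
  have hcle : ∀ k ≤ m, c k = b k := fun k hk => by simp [hc, truncExcess, hk, hb]
  have hcgt : c (m + 1) = 0 := by simp [hc, truncExcess]
  have hlam : ∀ k < m, c (k + 1) - c k = b (k + 1) - b k := fun k hk => by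
    rw [hcle _ hk, hcle _ hk.le]
  -- The same `ρ` serves every `k`: the point `(i, k)` gets the product weight `lam k * ρ i`.
  obtain ⟨ρ, hρ0, hρ1, hρm, hρ⟩ := exists_row_weights hmd ξ _ (b (m + 1)) hξ
    (sum_excess_mul_tailSum h0 hsum hmd) hbm1
  -- The weights are `b (k + 1) - b k` for `k < m` and `-b m` for `k = m`; they telescope to `-b 0 =
  -- 1`.
  refine ⟨m, hmd, fun k => c (k + 1) - c k, ρ, fun k hk => ?_, ?_, hρ0, hρ1, fun r hr => ?_⟩
  · rw [Finset.mem_range] at hk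
    rcases (Nat.lt_succ_iff.1 hk).eq_or_lt with rfl | hk
    · simp only [hcgt, hcle _ le_rfl]; linarith
    · simp only [hlam k hk, hb, excess_succ_eq_add]
      linarith [hu k (by omega)]
  · rw [Finset.sum_range_sub, hcgt, hcle 0 (Nat.zero_le _)]
    simp [hb, excess]
  · have hinner : ∀ k, ∑ i ∈ Finset.Icc m d, ρ i * (vertexSeq d η i k r : ℝ) =
        (if m ≤ r then ρ r else 0) * (tailSum d η k - 1) + (if r = k then (η r + 1 : ℝ) else 0) +
          if r < k then (η r : ℝ) else 0 := by
      intro k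
      have : ∀ i, ρ i * (vertexSeq d η i k r : ℝ) =
          (if r = i then ρ i * ((tailSum d η k : ℝ) - 1) else 0) +
          ρ i * ((if r = k then (η r + 1 : ℝ) else 0) + if r < k then (η r : ℝ) else 0) := by
        intro i
        unfold vertexSeq
        by_cases h1 : r = k
        · subst h1
          push_cast
          split_ifs <;> simp <;> ring
        · simp only [h1, if_false]
          push_cast
          split_ifs <;> ring
      rw [Finset.sum_congr rfl fun i _ => this i, Finset.sum_add_distrib, ← Finset.sum_mul, hρ1,
        Finset.sum_ite_eq]
      simp only [Finset.mem_Icc, hr, and_true]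
      split_ifs <;> ring
    simp only [hinner, mul_add, Finset.sum_add_distrib]
    have e1 : ∑ k ∈ Finset.range (m + 1), (c (k + 1) - c k) *
        ((if m ≤ r then ρ r else 0) * ((tailSum d η k : ℝ) - 1)) =
        (if m ≤ r then ρ r else 0) * (∑ k ∈ Finset.range m, (b (k + 1) - b k) *
          ((tailSum d η k : ℝ) - 1) - b m * (tailSum d η m - 1)) := by
      rw [Finset.sum_range_succ, hcgt, hcle m le_rfl,
        mul_sub (if m ≤ r then ρ r else 0) (∑ k ∈ Finset.range m, _), Finset.mul_sum]
      have : ∀ k ∈ Finset.range m, (c (k + 1) - c k) *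
          ((if m ≤ r then ρ r else 0) * ((tailSum d η k : ℝ) - 1)) =
          (if m ≤ r then ρ r else 0) * ((b (k + 1) - b k) * ((tailSum d η k : ℝ) - 1)) := by
        intro k hk
        rw [hlam k (Finset.mem_range.1 hk)]; ring
      rw [Finset.sum_congr rfl this]; ring
    have e2 : ∑ k ∈ Finset.range (m + 1), (c (k + 1) - c k) *
        (if r = k then (η r + 1 : ℝ) else 0) =
        if r ≤ m then (c (r + 1) - c r) * (η r + 1) else 0 := by
      simp only [mul_ite, mul_zero, Finset.sum_ite_eq, Finset.mem_range, Nat.lt_succ_iff]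
    -- The weights with `k > r` telescope to `-c (r + 1)`.
    have e3 : ∑ k ∈ Finset.range (m + 1), (c (k + 1) - c k) * (if r < k then (η r : ℝ) else 0) =
        if r ≤ m then -c (r + 1) * η r else 0 := by
      simp only [mul_ite, mul_zero]
      rw [← Finset.sum_filter, ← Finset.sum_mul]
      have hfil : (Finset.range (m + 1)).filter (fun k => r < k) = Finset.Ico (r + 1) (m + 1) := by
        ext k
        simp only [Finset.mem_filter, Finset.mem_range, Finset.mem_Ico]
        omega
      rw [hfil]
      split_ifs with h
      · rw [Finset.sum_Ico_sub c (by omega), hcgt, zero_sub]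
      · rw [Finset.Ico_eq_empty (by omega)]; simp
    rw [e1, e2, e3]
    have hbs : b (r + 1) = (1 + η r) * b r + ξ r := rfl
    rcases lt_trichotomy r m with h | h | h
    · rw [if_neg (by omega), if_pos h.le, if_pos h.le, hcle _ h, hcle _ h.le, hbs]; ring
    · subst h
      rw [if_pos le_rfl, if_pos le_rfl, if_pos le_rfl, hρm, hcgt, hcle _ le_rfl, hbs]; ring
    · rw [if_pos h.le, if_neg (by omega), if_neg (by omega), hρ r h hr]; ring

end Decomposition

/-! ### The hull and inequality descriptions of the polytope -/

section Polytope

variable {d : ℕ}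

/-- The homogeneous coordinate `r` as an affine form. -/
noncomputable def coordAff (d : ℕ) (s : ℝ) (r : ℕ) : (Fin d → ℝ) →ᵃ[ℝ] ℝ :=
  if h : d - r < d then (LinearMap.proj ⟨d - r, h⟩ : (Fin d → ℝ) →ₗ[ℝ] ℝ).toAffineMap
  else AffineMap.const ℝ _ s - (∑ i, LinearMap.proj i : (Fin d → ℝ) →ₗ[ℝ] ℝ).toAffineMap

theorem coordAff_apply (s : ℝ) (r : ℕ) (x : Fin d → ℝ) : coordAff d s r x = homCoord s x r := by
  unfold coordAff homCoord
  split <;> simp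

/-- The accumulated excess as an affine form. -/
noncomputable def excessAff (d : ℕ) (s : ℝ) (η : ℕ → ℤ) : ℕ → (Fin d → ℝ) →ᵃ[ℝ] ℝ
  | 0 => AffineMap.const ℝ _ (-1)
  | r + 1 => (1 + η r : ℝ) • excessAff d s η r + coordAff d s r

theorem excessAff_apply (s : ℝ) (η : ℕ → ℤ) (r : ℕ) (x : Fin d → ℝ) :
    excessAff d s η r x = excess η (homCoord s x) r := by
  induction r with
  | zero => simp [excessAff, excess]
  | succ r ih => simp [excessAff, excess, ih, coordAff_apply]

/-- The entries of `θ` in reversed order, preceded by `0`. -/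
def revSeq (θ : Fin d → ℤ) : ℕ → ℤ := homCoord (∑ i, θ i) θ

/-- The facet inequalities of the grevlex polytope. -/
noncomputable def facetForm (θ : Fin d → ℤ) : Fin d ⊕ Fin d → (Fin d → ℝ) →ᵃ[ℝ] ℝ
  | .inl i => coordAff d (∑ i, θ i : ℤ) (i + 1)
  | .inr i => coordAff d (∑ i, θ i : ℤ) i +
      (revSeq θ i : ℝ) • excessAff d (∑ i, θ i : ℤ) (revSeq θ) i

/-- The homogeneous coordinates of a point with respect to `θ`. -/
def homSeq (θ : Fin d → ℤ) (x : Fin d → ℝ) : ℕ → ℝ := homCoord ((∑ i, θ i : ℤ) : ℝ) x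

theorem facetForm_inl (θ : Fin d → ℤ) (i : Fin d) (x : Fin d → ℝ) :
    facetForm θ (.inl i) x = homSeq θ x (i + 1) := coordAff_apply _ _ _

theorem facetForm_inr (θ : Fin d → ℤ) (i : Fin d) (x : Fin d → ℝ) :
    facetForm θ (.inr i) x = upperForm (revSeq θ) (homSeq θ x) i := by
  simp [facetForm, coordAff_apply, excessAff_apply, upperForm, homSeq]

theorem mem_hPolytope_facetForm {θ : Fin d → ℤ} {x : Fin d → ℝ} :
    x ∈ hPolytope (facetForm θ) ↔ (∀ r, 1 ≤ r → r ≤ d → 0 ≤ homSeq θ x r) ∧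
      ∀ r < d, 0 ≤ upperForm (revSeq θ) (homSeq θ x) r := by
  constructor
  · intro h
    refine ⟨fun r h1 hr => ?_, fun r hr => ?_⟩
    · have := h (.inl ⟨r - 1, by omega⟩)
      rw [facetForm_inl] at this
      simpa [Nat.sub_add_cancel h1] using this
    · have := h (.inr ⟨r, hr⟩)
      rwa [facetForm_inr] at this
  · rintro ⟨h1, h2⟩ (i | i)
    · rw [facetForm_inl]; exact h1 _ (by omega) (by omega)
    · rw [facetForm_inr]; exact h2 _ i.2

theorem revSeq_zero (θ : Fin d → ℤ) : revSeq θ 0 = 0 := by simp [revSeq, homCoord_zero]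

theorem revSeq_pos {θ : Fin d → ℤ} (hθ : ∀ i, 1 ≤ θ i) (r : ℕ) (h1 : 1 ≤ r) (hr : r ≤ d) :
    1 ≤ revSeq θ r := by
  rw [revSeq, homCoord_of_pos _ _ h1 hr]; exact hθ _

theorem tailSum_revSeq (θ : Fin d → ℤ) : tailSum d (revSeq θ) 0 = ∑ i, θ i := by
  have h := sum_homCoord (∑ i, θ i) θ
  rw [Finset.sum_range_succ'] at h
  have h0 : homCoord (∑ i, θ i) θ 0 = 0 := revSeq_zero θ
  rw [h0, add_zero] at h
  rw [← h, tailSum, Finset.range_eq_Ico, Finset.sum_Ico_add' (homCoord (∑ i, θ i) θ) 0 d 1]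
  congr 1

/-- The integer point with homogeneous coordinates `vertexSeq d η i k`. -/
def vertexPt (θ : Fin d → ℤ) (i k : ℕ) : Fin d → ℤ := ptOf d (vertexSeq d (revSeq θ) i k)

theorem homCoord_vertexPt (θ : Fin d → ℤ) {i k r : ℕ} (hi : i ≤ d) (hk : k ≤ d) (hr : r ≤ d) :
    homCoord (∑ i, θ i) (vertexPt θ i k) r = vertexSeq d (revSeq θ) i k r := by
  apply homCoord_ptOf _ hr
  rw [sum_vertexSeq _ (revSeq_zero θ) hi hk, tailSum_revSeq]

theorem homSeq_realPoint (θ x : Fin d → ℤ) (r : ℕ) :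
    homSeq θ (realPoint x) r = (homCoord (∑ i, θ i) x r : ℤ) := homCoord_realPoint _ _ _

theorem homSeq_vertexPt (θ : Fin d → ℤ) {i k r : ℕ} (hi : i ≤ d) (hk : k ≤ d) (hr : r ≤ d) :
    homSeq θ (realPoint (vertexPt θ i k)) r = vertexSeq d (revSeq θ) i k r := by
  rw [homSeq_realPoint, homCoord_vertexPt θ hi hk hr]

theorem vertexPt_mem {θ : Fin d → ℤ} (hθ : ∀ i, 1 ≤ θ i) {i k : ℕ} (hki : k ≤ i) (hi : i ≤ d) :
    0 ≤ vertexPt θ i k ∧ GrevlexLe (vertexPt θ i k) θ := by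
  have hk : k ≤ d := hki.trans hi
  have hT := le_tailSum (revSeq_pos hθ) hk
  have hη : ∀ r ≤ d, 0 ≤ revSeq θ r := by
    intro r hr
    rcases Nat.eq_zero_or_pos r with rfl | h
    · rw [revSeq_zero]
    · linarith [revSeq_pos hθ r h hr]
  -- For `k = d` the tail is empty, `-1` and `+1` cancel, and the point is `θ`. For `k < d` the tail
  -- is at least `1`, so entry `i` is nonnegative and entry `k` exceeds that of `θ`.
  rcases hk.eq_or_lt with rfl | hkd
  · obtain rfl : i = k := by omega
    have hv : ∀ r ≤ i, vertexSeq i (revSeq θ) i i r = revSeq θ r := by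
      intro r hr
      unfold vertexSeq
      rw [tailSum_self]
      rcases hr.eq_or_lt with rfl | h
      · simp
      · simp [h.ne, h]
    have : vertexPt θ i i = θ := by
      apply ext_homCoord (s := ∑ i, θ i)
      intro r _ hr
      rw [homCoord_vertexPt θ le_rfl le_rfl hr, hv r hr, revSeq]
    rw [this]
    exact ⟨fun i => by have := hθ i; simp; omega, Or.inl rfl |> Or.inr ∘ And.intro rfl⟩
  · have hT1 : 1 ≤ tailSum d (revSeq θ) k := by omega
    constructor
    · intro j
      simp only [vertexPt, ptOf, vertexSeq, Pi.zero_apply]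
      have := hη k hk
      have := hη (d - j) (by omega)
      split_ifs <;> omega
    · refine grevlexLe_iff.2 (Or.inr ⟨k, hk, ?_, fun s hs => ?_⟩)
      · rw [homCoord_vertexPt θ hi hk hk, ← revSeq]
        unfold vertexSeq
        simp only [if_true, lt_irrefl, if_false]
        split_ifs <;> omega
      · rw [homCoord_vertexPt θ hi hk (by omega), ← revSeq]
        unfold vertexSeq
        rw [if_neg (by omega), if_neg (by omega), if_pos hs]; ring

/-- The vertices of the grevlex polytope. -/
def vertexSet (θ : Fin d → ℤ) : Set (Fin d → ℝ) :=
  {x | ∃ i k, i ≤ d ∧ (i = k ∨ k + 1 < i) ∧ x = realPoint (vertexPt θ i k)}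

/-- With `T = tailSum k`, the points `(k+1, k+1)`, `(k, k)` and `(k+1, k)` agree off positions `k`
and `k+1`, where they read `(η_k, T)`, `(η_k + T, 0)` and `(η_k + 1, T - 1)`. So the third divides
the segment of the first two with weights `(T - 1)/T` and `1/T`. -/
theorem vertexPt_succ_mem {θ : Fin d → ℤ} (hθ : ∀ i, 1 ≤ θ i) {k : ℕ} (hk : k < d) :
    realPoint (vertexPt θ (k + 1) k) ∈ convexHull ℝ (vertexSet θ) := by
  have hT := le_tailSum (revSeq_pos hθ) hk.le
  have hT1 : 1 ≤ tailSum d (revSeq θ) k := by omega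
  have hTr : (1 : ℝ) ≤ tailSum d (revSeq θ) k := by exact_mod_cast hT1
  have hts := tailSum_eq_add (revSeq θ) hk
  have hts' : (tailSum d (revSeq θ) k : ℝ) = revSeq θ (k + 1) + tailSum d (revSeq θ) (k + 1) := by
    exact_mod_cast hts
  have hw : ∀ k ≤ d, realPoint (vertexPt θ k k) ∈ convexHull ℝ (vertexSet θ) := fun k hk =>
    subset_convexHull ℝ _ ⟨k, k, hk, Or.inl rfl, rfl⟩
  have hne : (tailSum d (revSeq θ) k : ℝ) ≠ 0 := by linarith
  convert convex_convexHull ℝ (vertexSet θ) (hw (k + 1) hk) (hw k hk.le)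
    (a := ((tailSum d (revSeq θ) k : ℝ) - 1) / tailSum d (revSeq θ) k)
    (b := 1 / tailSum d (revSeq θ) k)
    (div_nonneg (by linarith) (by linarith)) (by positivity) (by field_simp; ring) using 1
  ext j
  simp only [realPoint, vertexPt, ptOf, vertexSeq, Pi.add_apply, Pi.smul_apply, smul_eq_mul]
  generalize d - (j : ℕ) = r
  rcases lt_trichotomy r k with h | h | h
  · have h1 : r ≠ k := by omega
    have h2 : r ≠ k + 1 := by omega
    have h3 : r < k + 1 := by omega
    simp only [h, h1, h2, h3, if_true, if_false]
    push_cast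
    field_simp
    ring
  · subst h
    simp
    field_simp
    ring
  · by_cases h4 : r = k + 1
    · subst h4
      simp
      rw [hts'] at hne ⊢
      field_simp
      ring
    · have h1 : r ≠ k := by omega
      have h2 : ¬ r < k := by omega
      have h3 : ¬ r < k + 1 := by omega
      simp [h1, h2, h3, h4]

theorem vertexPt_mem_convexHull {θ : Fin d → ℤ} (hθ : ∀ i, 1 ≤ θ i) {i k : ℕ} (hki : k ≤ i)
    (hi : i ≤ d) : realPoint (vertexPt θ i k) ∈ convexHull ℝ (vertexSet θ) := by
  by_cases h : i = k + 1
  · subst h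
    exact vertexPt_succ_mem hθ hi
  · exact subset_convexHull ℝ _ ⟨i, k, hi, by omega, rfl⟩

theorem hPolytope_subset {θ : Fin d → ℤ} (hθ : ∀ i, 1 ≤ θ i) :
    hPolytope (facetForm θ) ⊆ convexHull ℝ (vertexSet θ) := by
  intro x hx
  rw [mem_hPolytope_facetForm] at hx
  obtain ⟨m, hm, lam, ρ, hl0, hl1, hρ0, hρ1, h⟩ := exists_weights (revSeq_zero θ)
    (by rw [tailSum_revSeq]; exact sum_homCoord _ x) hx.1 hx.2
  have hmem : ∑ k ∈ Finset.range (m + 1), lam k • ∑ i ∈ Finset.Icc m d,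
      ρ i • realPoint (vertexPt θ i k) ∈ convexHull ℝ (vertexSet θ) := by
    refine (convex_convexHull ℝ _).sum_mem hl0 hl1 fun k hk => ?_
    refine (convex_convexHull ℝ _).sum_mem hρ0 hρ1 fun i hi => ?_
    rw [Finset.mem_range] at hk
    rw [Finset.mem_Icc] at hi
    exact vertexPt_mem_convexHull hθ (by omega) hi.2
  convert hmem
  ext j
  have hj := h (d - j) (by omega)
  rw [homSeq, homCoord_sub] at hj
  rw [← hj]
  simp [Finset.sum_apply, realPoint, vertexPt, ptOf]

theorem realPoint_mem_hPolytope {θ x : Fin d → ℤ} (hθ : ∀ i, 1 ≤ θ i) (hx : 0 ≤ x)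
    (hg : GrevlexLe x θ) : realPoint x ∈ hPolytope (facetForm θ) := by
  rw [mem_hPolytope_facetForm]
  have hpos : ∀ r, 1 ≤ r → r ≤ d → 0 ≤ homSeq θ (realPoint x) r := by
    intro r h1 hr
    rw [homSeq_realPoint, homCoord_of_pos _ _ h1 hr]
    exact_mod_cast hx _
  refine ⟨hpos, fun r hr => ?_⟩
  set ξ := homSeq θ (realPoint x) with hξ
  have hηnn : ∀ r ≤ d, (0 : ℝ) ≤ revSeq θ r := by
    intro r hr
    rcases Nat.eq_zero_or_pos r with rfl | h
    · simp [revSeq_zero]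
    · exact_mod_cast (zero_le_one.trans (revSeq_pos hθ r h hr))
  rcases grevlexLe_iff.1 hg with rfl | ⟨s, hs, hlt, heq⟩
  · have hη : ∀ r, ξ r = revSeq x r := fun r => by rw [hξ, homSeq_realPoint, revSeq]
    rw [upperForm, excess_eq_neg_one (r := r) (fun s _ => hη s) r le_rfl, hη]
    linarith
  · have heq' : ∀ t < s, ξ t = revSeq θ t := fun t ht => by
      rw [hξ, homSeq_realPoint, heq t ht, revSeq]
    have hlt' : (revSeq θ s : ℝ) + 1 ≤ ξ s := by
      rw [hξ, homSeq_realPoint]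
      exact_mod_cast hlt
    have hneg := excess_eq_neg_one heq'
    rcases lt_trichotomy r s with h | h | h
    · rw [upperForm, hneg r h.le, heq' r h]
      linarith
    · subst h
      rw [upperForm, hneg r le_rfl]
      linarith
    -- After the first difference the excess is nonnegative and, as `η` and `ξ` are too, it remains
    -- so.
    · have hnn : ∀ t, s < t → t ≤ r → 0 ≤ excess (revSeq θ) ξ t := by
        intro t ht
        induction t, ht using Nat.le_induction with
        | base =>
          intro _
          rw [excess, hneg s le_rfl]
          linarith
        | succ t ht ih =>
          intro htr
          have := ih (by omega)
          have h1 := hηnn t (by omega)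
          have h2 := hpos t (by omega) (by omega)
          rw [excess]
          positivity
      have h1 := hηnn r hr.le
      have h2 := hpos r (by omega) hr.le
      have h3 := hnn r h le_rfl
      rw [upperForm]
      positivity

theorem convexHull_vertexSet_subset {θ : Fin d → ℤ} (hθ : ∀ i, 1 ≤ θ i) :
    convexHull ℝ (vertexSet θ) ⊆ grevlexPolytope θ := by
  apply convexHull_mono
  rintro _ ⟨i, k, hi, hik, rfl⟩
  exact ⟨_, vertexPt_mem hθ (by omega) hi, rfl⟩

theorem grevlexPolytope_subset {θ : Fin d → ℤ} (hθ : ∀ i, 1 ≤ θ i) :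
    grevlexPolytope θ ⊆ hPolytope (facetForm θ) := by
  apply convexHull_min _ (convex_hPolytope _)
  rintro _ ⟨x, ⟨hx, hg⟩, rfl⟩
  exact realPoint_mem_hPolytope hθ hx hg

theorem grevlexPolytope_eq_hPolytope {θ : Fin d → ℤ} (hθ : ∀ i, 1 ≤ θ i) :
    grevlexPolytope θ = hPolytope (facetForm θ) :=
  (grevlexPolytope_subset hθ).antisymm
    ((hPolytope_subset hθ).trans (convexHull_vertexSet_subset hθ))

theorem grevlexPolytope_eq_convexHull {θ : Fin d → ℤ} (hθ : ∀ i, 1 ≤ θ i) :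
    grevlexPolytope θ = convexHull ℝ (vertexSet θ) :=
  ((grevlexPolytope_subset hθ).trans (hPolytope_subset hθ)).antisymm
    (convexHull_vertexSet_subset hθ)

theorem finite_vertexSet (θ : Fin d → ℤ) : (vertexSet θ).Finite := by
  apply ((Set.finite_Iic (d, d)).image fun p : ℕ × ℕ => realPoint (vertexPt θ p.1 p.2)).subset
  rintro _ ⟨i, k, hi, hik, rfl⟩
  exact ⟨(i, k), ⟨hi, by dsimp; omega⟩, rfl⟩

end Polytope

/-! ### Incidences between vertices and facets, and antipodal pairs -/

section Incidence

variable {d : ℕ}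

/-- The homogeneous coordinate `r` vanishes on the vertex with indices `i`, `k`. -/
theorem homSeq_vertexPt_eq_zero (θ : Fin d → ℤ) {i k r : ℕ} (hi : i ≤ d) (hk : k ≤ d) (hr : r ≤ d)
    (hkr : k < r) (hri : r ≠ i) : homSeq θ (realPoint (vertexPt θ i k)) r = 0 := by
  rw [homSeq_vertexPt θ hi hk hr, vertexSeq, if_neg hri, if_neg (by omega), if_neg (by omega)]
  simp

theorem excess_vertexPt (θ : Fin d → ℤ) {i k r : ℕ} (hi : i ≤ d) (hki : k ≤ i) (hr : r ≤ k) :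
    excess (revSeq θ) (homSeq θ (realPoint (vertexPt θ i k))) r = -1 := by
  refine excess_eq_neg_one (r := k) (fun s hs => ?_) r hr
  rw [homSeq_vertexPt θ hi (by omega) (by omega), vertexSeq, if_neg (by omega), if_neg (by omega),
    if_pos hs]
  simp

/-- The surplus `+1` at position `k` lifts the excess from `-1` to exactly `0`, and the zeros
between `k` and `i` keep it there. -/
theorem excess_vertexPt_between (θ : Fin d → ℤ) {i k r : ℕ} (hi : i ≤ d) (hkr : k < r)
    (hr : r ≤ i) : excess (revSeq θ) (homSeq θ (realPoint (vertexPt θ i k))) r = 0 := by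
  induction r, hkr using Nat.le_induction with
  | base =>
    rw [excess, excess_vertexPt θ hi (by omega) le_rfl, homSeq_vertexPt θ hi (by omega) (by omega),
      vertexSeq, if_neg (by omega), if_pos rfl, if_neg (by omega)]
    push_cast
    ring
  | succ r hr' ih =>
    rw [excess, ih (by omega), homSeq_vertexPt_eq_zero θ hi (by omega) (by omega) hr' (by omega)]
    ring

theorem upperForm_vertexPt_eq_zero (θ : Fin d → ℤ) {i k r : ℕ} (hi : i ≤ d) (hki : k ≤ i)
    (h : r < k ∨ k < r ∧ r < i) :
    upperForm (revSeq θ) (homSeq θ (realPoint (vertexPt θ i k))) r = 0 := by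
  have h1 := excess_succ_eq_add (revSeq θ) (homSeq θ (realPoint (vertexPt θ i k))) r
  rcases h with h | ⟨h, h'⟩
  · rw [excess_vertexPt θ hi hki h, excess_vertexPt θ hi hki h.le] at h1
    linarith
  · rw [excess_vertexPt_between θ hi (by omega) h', excess_vertexPt_between θ hi h h'.le] at h1
    linarith

theorem upperForm_vertexPt_self (θ : Fin d → ℤ) {i k : ℕ} (hi : i ≤ d) (hki : k < i) :
    upperForm (revSeq θ) (homSeq θ (realPoint (vertexPt θ i k))) k = 1 := by
  have h1 := excess_succ_eq_add (revSeq θ) (homSeq θ (realPoint (vertexPt θ i k))) k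
  rw [excess_vertexPt_between θ hi (by omega) hki, excess_vertexPt θ hi hki.le le_rfl] at h1
  linarith

theorem upperForm_vertexPt_diag (θ : Fin d → ℤ) {k : ℕ} (hk : k ≤ d) :
    upperForm (revSeq θ) (homSeq θ (realPoint (vertexPt θ k k))) k = tailSum d (revSeq θ) k := by
  rw [upperForm, excess_vertexPt θ hk le_rfl le_rfl, homSeq_vertexPt θ hk hk hk, vertexSeq,
    if_pos rfl, if_pos rfl, if_neg (lt_irrefl _)]
  push_cast
  ring

theorem revSeq_nonneg {θ : Fin d → ℤ} (hθ : ∀ i, 1 ≤ θ i) {r : ℕ} (hr : r ≤ d) :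
    0 ≤ revSeq θ r := by
  rcases Nat.eq_zero_or_pos r with rfl | h
  · rw [revSeq_zero]
  · linarith [revSeq_pos hθ r h hr]

theorem homSeq_vertexPt_diag_pos {θ : Fin d → ℤ} (hθ : ∀ i, 1 ≤ θ i) {k : ℕ} (h1 : 1 ≤ k)
    (hk : k ≤ d) : 0 < homSeq θ (realPoint (vertexPt θ k k)) k := by
  have hT := le_tailSum (revSeq_pos hθ) hk
  have hη := revSeq_pos hθ k h1 hk
  rw [homSeq_vertexPt θ hk hk hk, vertexSeq, if_pos rfl, if_pos rfl, if_neg (lt_irrefl _)]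
  have : 0 < tailSum d (revSeq θ) k - 1 + (revSeq θ k + 1) + 0 := by omega
  exact_mod_cast this

theorem homSeq_vertexPt_pos {θ : Fin d → ℤ} (hθ : ∀ i, 1 ≤ θ i) {i k : ℕ} (hi : i ≤ d)
    (hki : k + 1 < i) : 0 < homSeq θ (realPoint (vertexPt θ i k)) i := by
  have hT := le_tailSum (revSeq_pos hθ) (by omega : k ≤ d)
  rw [homSeq_vertexPt θ hi (by omega) hi, vertexSeq, if_pos rfl, if_neg (by omega),
    if_neg (by omega)]
  have : 0 < tailSum d (revSeq θ) k - 1 + 0 + 0 := by omega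
  exact_mod_cast this

theorem realPoint_zero : realPoint (0 : Fin d → ℤ) = 0 := by
  ext; simp [realPoint]

theorem vertexPt_zero_zero (θ : Fin d → ℤ) : realPoint (vertexPt θ 0 0) = 0 := by
  rw [← realPoint_zero]
  congr 1
  ext j
  have : d - (j : ℕ) ≠ 0 := by omega
  simp [vertexPt, ptOf, vertexSeq, this]

theorem vertexPt_top (θ : Fin d → ℤ) : realPoint (vertexPt θ d d) = realPoint θ := by
  congr 1
  apply ext_homCoord (s := ∑ i, θ i)
  intro r _ hr
  rw [homCoord_vertexPt θ le_rfl le_rfl hr, ← revSeq, vertexSeq, tailSum_self]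
  rcases hr.eq_or_lt with rfl | h
  · simp
  · simp [h.ne, h]

theorem homSeq_zero_pt (θ : Fin d → ℤ) {r : ℕ} (h1 : 1 ≤ r) (hr : r ≤ d) :
    homSeq θ 0 r = 0 := by
  rw [homSeq, homCoord_of_pos _ _ h1 hr]; rfl

theorem homSeq_theta (θ : Fin d → ℤ) (r : ℕ) : homSeq θ (realPoint θ) r = revSeq θ r :=
  homSeq_realPoint _ _ _

theorem upperForm_theta (θ : Fin d → ℤ) (r : ℕ) :
    upperForm (revSeq θ) (homSeq θ (realPoint θ)) r = 0 := by
  rw [upperForm, excess_eq_neg_one (r := r) (fun s _ => homSeq_theta θ s) r le_rfl, homSeq_theta]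
  ring

/-- At the origin all the mass is slack, so the excess at `1` is `∑ θ - 1`, positive because `d ≥
2`. -/
theorem excess_zero_pt_pos (hd : 2 ≤ d) {θ : Fin d → ℤ} (hθ : ∀ i, 1 ≤ θ i) {r : ℕ} (h1 : 1 ≤ r)
    (hr : r ≤ d) : 0 < excess (revSeq θ) (homSeq θ 0) r := by
  have hT := le_tailSum (revSeq_pos hθ) (Nat.zero_le d)
  induction r, h1 using Nat.le_induction with
  | base =>
    have h0 : homSeq θ 0 0 = (tailSum d (revSeq θ) 0 : ℝ) := by
      rw [homSeq, homCoord_zero, tailSum_revSeq]; simp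
    have : (2 : ℝ) ≤ tailSum d (revSeq θ) 0 := by
      have : (2 : ℤ) ≤ tailSum d (revSeq θ) 0 := by push_cast at hT; omega
      exact_mod_cast this
    simp only [excess, h0, revSeq_zero]
    push_cast
    linarith
  | succ r h1 ih =>
    have := ih (by omega)
    have h2 : (0 : ℝ) ≤ revSeq θ r := by exact_mod_cast revSeq_nonneg hθ (by omega)
    rw [excess, homSeq_zero_pt θ h1 (by omega)]
    positivity

theorem upperForm_zero_pt_pos (hd : 2 ≤ d) {θ : Fin d → ℤ} (hθ : ∀ i, 1 ≤ θ i) {r : ℕ}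
    (hr : r < d) : 0 < upperForm (revSeq θ) (homSeq θ 0) r := by
  rcases Nat.eq_zero_or_pos r with rfl | h1
  · have := excess_zero_pt_pos hd hθ le_rfl (by omega : 1 ≤ d)
    rw [excess_succ_eq_add] at this
    simp only [excess] at this
    linarith
  · have := excess_zero_pt_pos hd hθ h1 hr.le
    have h2 : (0 : ℝ) < revSeq θ r := by
      exact_mod_cast zero_lt_one.trans_le (revSeq_pos hθ r h1 hr.le)
    rw [upperForm, homSeq_zero_pt θ h1 hr.le]
    positivity

theorem vertexPt_mem_hPolytope {θ : Fin d → ℤ} (hθ : ∀ i, 1 ≤ θ i) {i k : ℕ} (hki : k ≤ i)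
    (hi : i ≤ d) : realPoint (vertexPt θ i k) ∈ hPolytope (facetForm θ) :=
  realPoint_mem_hPolytope hθ (vertexPt_mem hθ hki hi).1 (vertexPt_mem hθ hki hi).2

theorem separated_facetForm (hd : 2 ≤ d) {θ : Fin d → ℤ} (hθ : ∀ i, 1 ≤ θ i) :
    Separated (facetForm θ) := by
  have hz : (0 : Fin d → ℝ) ∈ hPolytope (facetForm θ) := by
    rw [← vertexPt_zero_zero θ]
    exact vertexPt_mem_hPolytope hθ le_rfl (Nat.zero_le d)
  have ht : realPoint θ ∈ hPolytope (facetForm θ) := by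
    rw [← vertexPt_top θ]
    exact vertexPt_mem_hPolytope hθ le_rfl le_rfl
  rintro (a | a) (b | b) hab
  · simp only [facetForm_inl]
    have hne : (a : ℕ) ≠ b := fun h => hab (by rw [Fin.ext h])
    -- The witnesses have indices `(b+1, 0)` if `a < b`, and `(b+1, b+1)` if `b < a`.
    rcases lt_or_gt_of_ne hne with h | h
    · exact ⟨_, vertexPt_mem_hPolytope hθ (Nat.zero_le (b + 1)) b.2,
        homSeq_vertexPt_eq_zero θ b.2 (by omega) (by omega) (by omega) (by omega),
        homSeq_vertexPt_pos hθ b.2 (by omega)⟩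
    · exact ⟨_, vertexPt_mem_hPolytope hθ le_rfl b.2,
        homSeq_vertexPt_eq_zero θ b.2 b.2 (by omega) (by omega) (by omega),
        homSeq_vertexPt_diag_pos hθ (by omega) b.2⟩
  · simp only [facetForm_inl, facetForm_inr]
    exact ⟨0, hz, homSeq_zero_pt θ (by omega) (by omega), upperForm_zero_pt_pos hd hθ b.2⟩
  · simp only [facetForm_inl, facetForm_inr]
    refine ⟨_, ht, upperForm_theta θ a, ?_⟩
    rw [homSeq_theta]
    exact_mod_cast zero_lt_one.trans_le (revSeq_pos hθ (b + 1) (by omega) b.2)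
  · simp only [facetForm_inr]
    have hne : (a : ℕ) ≠ b := fun h => hab (by rw [Fin.ext h])
    -- The witnesses have indices `(b, b)` if `a < b`, and `(d, b)` if `b < a`.
    rcases lt_or_gt_of_ne hne with h | h
    · refine ⟨_, vertexPt_mem_hPolytope hθ le_rfl b.2.le,
        upperForm_vertexPt_eq_zero θ b.2.le le_rfl (Or.inl h), ?_⟩
      have := le_tailSum (revSeq_pos hθ) b.2.le
      rw [upperForm_vertexPt_diag θ b.2.le]
      exact_mod_cast (by omega : 0 < tailSum d (revSeq θ) b)
    · refine ⟨_, vertexPt_mem_hPolytope hθ b.2.le le_rfl,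
        upperForm_vertexPt_eq_zero θ le_rfl b.2.le (Or.inr ⟨h, a.2⟩), ?_⟩
      rw [upperForm_vertexPt_self θ le_rfl b.2]
      exact one_pos

theorem nontrivial_facetIndex (hd : 1 ≤ d) : Nontrivial (Fin d ⊕ Fin d) :=
  ⟨.inl ⟨0, hd⟩, .inr ⟨0, hd⟩, by simp⟩

/-- A combinatorial description of the pairs of vertices that lie on no common facet. -/
theorem index_of_no_common_facet (hd : 3 ≤ d) {i k i' k' : ℕ} (hi : i ≤ d) (hi' : i' ≤ d)
    (hik : i = k ∨ k + 1 < i) (hik' : i' = k' ∨ k' + 1 < i') (hne : ¬ (i = i' ∧ k = k'))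
    (h1 : ∀ r, 1 ≤ r → r ≤ d → ¬ ((k < r ∧ r ≠ i) ∧ (k' < r ∧ r ≠ i')))
    (h2 : ∀ r < d, ¬ ((r < k ∨ k < r ∧ r < i) ∧ (r < k' ∨ k' < r ∧ r < i'))) :
    ((i = 0 ∧ k = 0) ∧ (i' = d ∧ k' = d)) ∨ ((i = d ∧ k = d) ∧ (i' = 0 ∧ k' = 0)) ∨
    (d = 3 ∧ (((i = 3 ∧ k = 1) ∧ (i' = 2 ∧ k' = 0)) ∨ ((i = 2 ∧ k = 0) ∧ (i' = 3 ∧ k' = 1)))) := by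
  have a1 := h1 d (by omega) le_rfl
  have b1 := h2 0 (by omega)
  rcases hik with rfl | hik <;> rcases hik' with rfl | hik'
  -- Two diagonal vertices: `a1` forces one index to be `d`, and `b1` forces one to be `0`.
  · clear h1 h2
    omega
  -- Diagonal against off-diagonal: `a1`, `a2`, `b1` leave `k' = 0` and `k ≥ d - 1`. Then `b6`
  -- excludes `k = d`, and `b4` excludes `k = d - 1`, where `i' = d`.
  · have a2 := h1 (d - 1) (by omega) (by omega)
    have b4 := h2 (d - 2) (by omega)
    have b6 := h2 (i' - 1) (by omega)
    clear h1 h2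
    exfalso
    omega
  · have a2 := h1 (d - 1) (by omega) (by omega)
    have b4 := h2 (d - 2) (by omega)
    have b5 := h2 (i - 1) (by omega)
    clear h1 h2
    exfalso
    omega
  -- Both off-diagonal: `a1`, `a2` give `{i, i'} = {d - 1, d}`, and `b1`, `b2` give `{k, k'} = {0,
  -- 1}`. For `d ≥ 4`, position `d - 2` then vanishes on both, against `a3`.
  · have a2 := h1 (d - 1) (by omega) (by omega)
    have a3 := h1 (d - 2) (by omega) (by omega)
    have b2 := h2 1 (by omega)
    clear h1 h2
    right
    right
    have hdi : d = i ∨ d = i' := by omega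
    rcases hdi with rfl | rfl
    · have hi2 : i' = d - 1 := by omega
      subst hi2
      omega
    · have hi2 : i = d - 1 := by omega
      subst hi2
      omega

theorem antipodal_subset (hd : 3 ≤ d) {θ : Fin d → ℤ} (hθ : ∀ i, 1 ≤ θ i) {u v : Fin d → ℝ}
    (h : IsAntipodalPair (grevlexPolytope θ) u v) :
    s(u, v) = s(0, realPoint θ) ∨
      d = 3 ∧ s(u, v) = s(realPoint (vertexPt θ 3 1), realPoint (vertexPt θ 2 0)) := by
  have : Nontrivial (Fin d ⊕ Fin d) := nontrivial_facetIndex (by omega)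
  have hu := h.1
  have hv := h.2.1
  rw [grevlexPolytope_eq_convexHull hθ] at hu hv
  obtain ⟨i, k, hi, hik, rfl⟩ := extremePoints_convexHull_subset hu
  obtain ⟨i', k', hi', hik', rfl⟩ := extremePoints_convexHull_subset hv
  rw [grevlexPolytope_eq_hPolytope hθ, isAntipodalPair_iff (separated_facetForm (by omega) hθ)] at h
  obtain ⟨-, -, hne, hno⟩ := h
  rw [← vertexPt_zero_zero θ, ← vertexPt_top θ]
  rcases index_of_no_common_facet hd hi hi' hik hik' (by rintro ⟨rfl, rfl⟩; exact hne rfl)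
    (by
      rintro r h1 hr ⟨ha, hb⟩
      have := hno (.inl ⟨r - 1, by omega⟩)
      simp only [facetForm_inl, Nat.sub_add_cancel h1] at this
      exact this ⟨homSeq_vertexPt_eq_zero θ hi (by omega) hr ha.1 ha.2,
        homSeq_vertexPt_eq_zero θ hi' (by omega) hr hb.1 hb.2⟩)
    (by
      rintro r hr ⟨ha, hb⟩
      have := hno (.inr ⟨r, hr⟩)
      simp only [facetForm_inr] at this
      exact this ⟨upperForm_vertexPt_eq_zero θ hi (by omega) ha,
        upperForm_vertexPt_eq_zero θ hi' (by omega) hb⟩)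
    with ⟨⟨rfl, rfl⟩, rfl, rfl⟩ | ⟨⟨rfl, rfl⟩, rfl, rfl⟩ |
      ⟨rfl, ⟨⟨rfl, rfl⟩, rfl, rfl⟩ | ⟨⟨rfl, rfl⟩, rfl, rfl⟩⟩
  · exact Or.inl rfl
  · exact Or.inl Sym2.eq_swap
  · exact Or.inr ⟨rfl, rfl⟩
  · exact Or.inr ⟨rfl, Sym2.eq_swap⟩

theorem IsAntipodalPair.symm {X : Set (Fin d → ℝ)} {u v : Fin d → ℝ} (h : IsAntipodalPair X u v) :
    IsAntipodalPair X v u :=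
  ⟨h.2.1, h.1, h.2.2.1.symm, fun F hF hm => h.2.2.2 F hF hm.symm⟩

theorem IsAntipodalPair.of_sym2_eq {X : Set (Fin d → ℝ)} {u v u' v' : Fin d → ℝ}
    (h : IsAntipodalPair X u' v') (he : s(u, v) = s(u', v')) : IsAntipodalPair X u v := by
  rcases Sym2.eq_iff.1 he with ⟨rfl, rfl⟩ | ⟨rfl, rfl⟩
  · exact h
  · exact h.symm

theorem zero_mem_extremePoints {θ : Fin d → ℤ} (hθ : ∀ i, 1 ≤ θ i) :
    (0 : Fin d → ℝ) ∈ (hPolytope (facetForm θ)).extremePoints ℝ := by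
  apply mem_extremePoints_of_tight
  · rw [← vertexPt_zero_zero θ]
    exact vertexPt_mem_hPolytope hθ le_rfl (Nat.zero_le d)
  · intro x h
    apply ext_homCoord (s := ((∑ i, θ i : ℤ) : ℝ))
    intro r h1 hr
    have h0 := homSeq_zero_pt θ h1 hr
    have := h (.inl ⟨r - 1, by omega⟩)
    simp only [facetForm_inl, Nat.sub_add_cancel h1] at this
    exact (this h0).trans h0.symm

theorem theta_mem_extremePoints {θ : Fin d → ℤ} (hθ : ∀ i, 1 ≤ θ i) :
    realPoint θ ∈ (hPolytope (facetForm θ)).extremePoints ℝ := by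
  apply mem_extremePoints_of_tight
  · rw [← vertexPt_top θ]
    exact vertexPt_mem_hPolytope hθ le_rfl le_rfl
  · intro x h
    -- Tightness of the upper inequalities determines the entries one at a time; the fixed total
    -- then determines the last.
    have hlt : ∀ r < d, homSeq θ x r = revSeq θ r := by
      intro r
      induction r using Nat.strong_induction_on with
      | _ r ih =>
        intro hr
        have := h (.inr ⟨r, hr⟩)
        simp only [facetForm_inr] at this
        have := this (upperForm_theta θ r)
        rw [upperForm, excess_eq_neg_one (r := r) (fun s hs => ih s hs (by omega)) r le_rfl] at this
        linarith
    have h1 := sum_homCoord ((∑ i, θ i : ℤ) : ℝ) x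
    have h2 := sum_homCoord ((∑ i, θ i : ℤ) : ℝ) (realPoint θ)
    change ∑ r ∈ Finset.range (d + 1), homSeq θ x r = _ at h1
    change ∑ r ∈ Finset.range (d + 1), homSeq θ (realPoint θ) r = _ at h2
    rw [Finset.sum_range_succ, Finset.sum_congr rfl fun r hr => hlt r (Finset.mem_range.1 hr)] at h1
    simp only [homSeq_theta] at h2
    rw [Finset.sum_range_succ] at h2
    apply ext_homCoord (s := ((∑ i, θ i : ℤ) : ℝ))
    intro r _ hr
    change homSeq θ x r = homSeq θ (realPoint θ) r
    rw [homSeq_theta]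
    rcases hr.eq_or_lt with rfl | hr
    · linarith
    · exact hlt r hr

theorem realPoint_theta_ne_zero (hd : 1 ≤ d) {θ : Fin d → ℤ} (hθ : ∀ i, 1 ≤ θ i) :
    (0 : Fin d → ℝ) ≠ realPoint θ := by
  intro h
  have h0 := congrFun h ⟨0, hd⟩
  have := hθ ⟨0, hd⟩
  simp only [realPoint, Pi.zero_apply] at h0
  have : θ ⟨0, hd⟩ = 0 := by exact_mod_cast h0.symm
  omega

theorem facetForm_xor (hd : 2 ≤ d) {θ : Fin d → ℤ} (hθ : ∀ i, 1 ≤ θ i) (i : Fin d ⊕ Fin d) :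
    Xor (facetForm θ i 0 = 0) (facetForm θ i (realPoint θ) = 0) := by
  rcases i with i | i
  · simp only [facetForm_inl]
    refine Or.inl ⟨homSeq_zero_pt θ (by omega) (by omega), ?_⟩
    rw [homSeq_theta]
    have := revSeq_pos hθ (i + 1) (by omega) (by omega)
    exact_mod_cast (by omega : revSeq θ (i + 1) ≠ 0)
  · simp only [facetForm_inr]
    exact Or.inr ⟨upperForm_theta θ i, (upperForm_zero_pt_pos hd hθ i.2).ne'⟩

theorem isAntipodalPair_zero_theta (hd : 2 ≤ d) {θ : Fin d → ℤ} (hθ : ∀ i, 1 ≤ θ i) :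
    IsAntipodalPair (grevlexPolytope θ) 0 (realPoint θ) := by
  have : Nontrivial (Fin d ⊕ Fin d) := nontrivial_facetIndex (by omega)
  rw [grevlexPolytope_eq_hPolytope hθ, isAntipodalPair_iff (separated_facetForm hd hθ)]
  refine ⟨zero_mem_extremePoints hθ, theta_mem_extremePoints hθ,
    realPoint_theta_ne_zero (by omega) hθ, fun i hi => ?_⟩
  rcases facetForm_xor hd hθ i with h | h
  · exact h.2 hi.2
  · exact h.2 hi.1

theorem isFullPolytope_grevlexPolytope (hd : 2 ≤ d) {θ : Fin d → ℤ} (hθ : ∀ i, 1 ≤ θ i) :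
    IsFullPolytope (grevlexPolytope θ) := by
  have : Nontrivial (Fin d ⊕ Fin d) := nontrivial_facetIndex (by omega)
  refine ⟨⟨vertexSet θ, finite_vertexSet θ, ⟨_, 0, 0, Nat.zero_le d, Or.inl rfl, rfl⟩,
    grevlexPolytope_eq_convexHull hθ⟩, ?_⟩
  rw [grevlexPolytope_eq_hPolytope hθ]
  exact affDim_hPolytope (separated_facetForm hd hθ)

theorem encard_facets_grevlexPolytope (hd : 2 ≤ d) {θ : Fin d → ℤ} (hθ : ∀ i, 1 ≤ θ i) :
    {F | IsFacet (grevlexPolytope θ) F}.encard = ((2 * d : ℕ) : ℕ∞) := by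
  have : Nontrivial (Fin d ⊕ Fin d) := nontrivial_facetIndex (by omega)
  rw [grevlexPolytope_eq_hPolytope hθ, encard_facets (separated_facetForm hd hθ)]
  simp [two_mul]

end Incidence

/-! ### The exceptional pair in dimension three -/

section ThreeDim

/-- Reversal matches `(i, k)` with `v^{d+1-i, d+1-k}`. -/
theorem vertexPt_three_one (θ : Fin 3 → ℤ) : vertexPt θ 3 1 = vPoint θ 1 3 := by
  ext i
  fin_cases i <;>
    simp [vertexPt, ptOf, vertexSeq, vPoint, tailSum, revSeq, homCoord, Fin.sum_univ_three,
      Finset.sum_Ioc_succ_top]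
  all_goals ring

theorem vertexPt_two_zero (θ : Fin 3 → ℤ) : vertexPt θ 2 0 = vPoint θ 2 4 := by
  ext i
  fin_cases i <;>
    simp [vertexPt, ptOf, vertexSeq, vPoint, tailSum, revSeq, homCoord, Fin.sum_univ_three,
      Finset.sum_Ioc_succ_top]
  all_goals ring

end ThreeDim

section ThreeDimAntipodal

theorem realPoint_vPoint_one_three (θ : Fin 3 → ℤ) :
    realPoint (vPoint θ 1 3) = ![(θ 0 + θ 1 - 1 : ℝ), 0, θ 2 + 1] := by
  ext i
  fin_cases i <;> simp [realPoint, vPoint, Fin.sum_univ_three]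

theorem realPoint_vPoint_two_four (θ : Fin 3 → ℤ) :
    realPoint (vPoint θ 2 4) = ![(0 : ℝ), θ 0 + θ 1 + θ 2 - 1, 0] := by
  ext i
  fin_cases i <;> simp [realPoint, vPoint, Fin.sum_univ_three]

theorem homSeq_three (θ : Fin 3 → ℤ) (x : Fin 3 → ℝ) :
    homSeq θ x 0 = θ 0 + θ 1 + θ 2 - (x 0 + x 1 + x 2) ∧ homSeq θ x 1 = x 2 ∧
      homSeq θ x 2 = x 1 ∧ homSeq θ x 3 = x 0 := by
  simp [homSeq, homCoord, Fin.sum_univ_three]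

theorem upperForm_three (θ : Fin 3 → ℤ) (x : Fin 3 → ℝ) :
    let t : ℝ := θ 0 + θ 1 + θ 2 - (x 0 + x 1 + x 2)
    upperForm (revSeq θ) (homSeq θ x) 0 = t ∧
      upperForm (revSeq θ) (homSeq θ x) 1 = x 2 + θ 2 * (t - 1) ∧
      upperForm (revSeq θ) (homSeq θ x) 2 = x 1 + θ 1 * ((1 + θ 2) * (t - 1) + x 2) := by
  obtain ⟨h0, h1, h2, -⟩ := homSeq_three θ x
  have e0 := revSeq_zero θ
  have e1 : revSeq θ 1 = θ 2 := by simp [revSeq, homCoord]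
  have e2 : revSeq θ 2 = θ 1 := by simp [revSeq, homCoord]
  simp only [upperForm, excess, h0, h1, h2, e0, e1, e2]
  push_cast
  refine ⟨by ring, by ring, by ring⟩

theorem isAntipodalPair_three {θ : Fin 3 → ℤ} (hθ : ∀ i, 1 ≤ θ i) :
    IsAntipodalPair (grevlexPolytope θ) (realPoint (vPoint θ 1 3)) (realPoint (vPoint θ 2 4)) := by
  have h0 : (1 : ℝ) ≤ θ 0 := by exact_mod_cast hθ 0
  have h1 : (1 : ℝ) ≤ θ 1 := by exact_mod_cast hθ 1
  have h2 : (1 : ℝ) ≤ θ 2 := by exact_mod_cast hθ 2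
  have hu := vertexPt_mem_hPolytope hθ (by omega : 1 ≤ 3) le_rfl
  have hv := vertexPt_mem_hPolytope hθ (by omega : 0 ≤ 2) (by omega)
  rw [vertexPt_three_one] at hu
  rw [vertexPt_two_zero] at hv
  have : Nontrivial (Fin 3 ⊕ Fin 3) := nontrivial_facetIndex (by omega)
  rw [grevlexPolytope_eq_hPolytope hθ,
    isAntipodalPair_iff (separated_facetForm (by omega) hθ)]
  refine ⟨mem_extremePoints_of_tight hu fun x h => ?_, mem_extremePoints_of_tight hv fun x h => ?_,
    fun h => ?_, ?_⟩
  · have a1 := h (.inl 1)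
    have a2 := h (.inr 0)
    have a3 := h (.inr 2)
    simp only [realPoint_vPoint_one_three, facetForm_inl, facetForm_inr] at a1 a2 a3 ⊢
    simp [homSeq_three, upperForm_three] at a1 a2 a3
    have b3 := a3 (Or.inr (by ring))
    rw [a2, a1] at b3
    have b4 : x 2 = θ 2 + 1 := by
      rcases mul_eq_zero.1 ((zero_add _).symm.trans b3) with h | h <;> linarith
    ext i
    fin_cases i <;> simp <;> linarith
  · have a1 := h (.inl 0)
    have a2 := h (.inl 2)
    have a3 := h (.inr 1)
    simp only [realPoint_vPoint_two_four, facetForm_inl, facetForm_inr] at a1 a2 a3 ⊢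
    simp [homSeq_three, upperForm_three] at a1 a2 a3
    rw [a1, a2] at a3
    have b4 : x 1 = θ 0 + θ 1 + θ 2 - 1 := by
      rcases mul_eq_zero.1 ((zero_add _).symm.trans a3) with h | h <;>
        linarith
    ext i
    fin_cases i <;> simp <;> linarith
  · rw [realPoint_vPoint_one_three, realPoint_vPoint_two_four] at h
    have := congrFun h 0
    simp at this
    linarith
  · rw [realPoint_vPoint_one_three, realPoint_vPoint_two_four]
    rintro (i | i) ⟨hi, hj⟩ <;> fin_cases i <;>
      simp [facetForm_inl, facetForm_inr, homSeq_three, upperForm_three] at hi hj <;>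
      nlinarith

end ThreeDimAntipodal

/-! ### Assembly of the theorem -/

theorem theorem4p1 (d : ℕ) (hd : 3 ≤ d) (θ : Fin d → ℤ) (hθ : ∀ i, 1 ≤ θ i) :
    IsDantzigFigure (grevlexPolytope θ) 0 (realPoint θ) ∧
    (∀ F, IsFacet (grevlexPolytope θ) F → Xor (0 ∈ F) (realPoint θ ∈ F)) ∧
    (4 ≤ d → ∀ u v : Fin d → ℝ,
      IsAntipodalPair (grevlexPolytope θ) u v ↔ s(u, v) = s(0, realPoint θ)) ∧
    (d = 3 →
      IsDantzigFigure (grevlexPolytope θ)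
        (realPoint (vPoint θ 1 3)) (realPoint (vPoint θ 2 4)) ∧
      s(realPoint (vPoint θ 1 3), realPoint (vPoint θ 2 4)) ≠ s(0, realPoint θ) ∧
      ∀ u v : Fin d → ℝ,
        IsAntipodalPair (grevlexPolytope θ) u v ↔
          s(u, v) = s(0, realPoint θ) ∨
          s(u, v) = s(realPoint (vPoint θ 1 3), realPoint (vPoint θ 2 4))) := by
  have hd2 : 2 ≤ d := by omega
  have hpoly := isFullPolytope_grevlexPolytope hd2 hθ
  have hcard := encard_facets_grevlexPolytope hd2 hθ
  have hanti := isAntipodalPair_zero_theta hd2 hθ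
  refine ⟨⟨hpoly, hcard, hanti⟩, fun F hF => ?_, fun h4 u v => ⟨fun h => ?_, hanti.of_sym2_eq⟩, ?_⟩
  · have : Nontrivial (Fin d ⊕ Fin d) := nontrivial_facetIndex (by omega)
    rw [grevlexPolytope_eq_hPolytope hθ] at hF
    obtain ⟨i, rfl⟩ := eq_hFace_of_isFacet (separated_facetForm hd2 hθ) hF
    have h0 := (zero_mem_extremePoints hθ).1
    have h1 := (theta_mem_extremePoints hθ).1
    rcases facetForm_xor hd2 hθ i with h | h
    · exact Or.inl ⟨⟨h0, h.1⟩, fun hm => h.2 hm.2⟩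
    · exact Or.inr ⟨⟨h1, h.1⟩, fun hm => h.2 hm.2⟩
  · rcases antipodal_subset hd hθ h with h | h
    · exact h
    · omega
  · rintro rfl
    have h3 := isAntipodalPair_three hθ
    refine ⟨⟨hpoly, hcard, h3⟩, fun h => ?_, fun u v => ⟨fun h => ?_, ?_⟩⟩
    · have hpos : (1 : ℝ) ≤ θ 0 ∧ (1 : ℝ) ≤ θ 1 ∧ (1 : ℝ) ≤ θ 2 :=
        ⟨by exact_mod_cast hθ 0, by exact_mod_cast hθ 1, by exact_mod_cast hθ 2⟩
      rw [realPoint_vPoint_one_three, realPoint_vPoint_two_four] at h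
      rcases Sym2.eq_iff.1 h with ⟨h, -⟩ | ⟨-, h⟩
      · have := congrFun h 2
        simp at this
        linarith
      · have := congrFun h 1
        simp at this
        linarith
    · rcases antipodal_subset hd hθ h with h | ⟨-, h⟩
      · exact Or.inl h
      · rw [vertexPt_three_one, vertexPt_two_zero] at h
        exact Or.inr h
    · rintro (h | h)
      · exact hanti.of_sym2_eq h
      · exact h3.of_sym2_eq h
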